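/- Let $N\ge 0$ and let $A_k, B_k$ ($k\in\mathbb R$) be complex $N\times N$ matrices whose entries are real-analytic functions of $k\in\mathbb R$, and suppose that for every $k\in\mathbb R$ the CPTP constraints $A_k^\dagger A_k+B_kB_k^\dagger\le I$ and $B_k^\dagger B_k\le I$ hold. Let $V_{k,u}\subseteq\mathbb C^N$ be the preserved subspace, i.e. the span of all vectors $v$ with $B_kv=bv$ for some $b\in\mathbb C$ with $|b|=1$, and let $P_{k,u}$ be the Hermitian (orthogonal) projector onto $V_{k,u}$. Then: 1. There is an integer $d\ge 0$ such that every bounded interval (in particular the Brillouin zone $[-\pi,\pi]$) contains only finitely many $k$ with $\dim V_{k,u}\ne d$. 2. For every $k\in\mathbb R$ there are Hermitian projectors $\tilde P_{k,u}$ and $P'_{k,u}$ with $P_{k,u}=\tilde P_{k,u}+P'_{k,u}$ such that (i) every bounded interval contains only finitely many $k$ with $P'_{k,u}\neq 0$; and (ii) $k\mapsto\tilde P_{k,u}$ extends to an analytic (holomorphic) matrix-valued function on an open neighbourhood $U\subseteq\mathbb C$ of the real axis. If moreover $A_k$ and $B_k$ are $2\pi$-periodic in $k$, as for lattice momenta (so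 that the exceptional momenta above are finitely many modulo $2\pi$), then $\tilde P_{k,u}$ and $P'_{k,u}$ are $2\pi$-periodic, and $U$ can be taken to be a strip $\{z\in\mathbb C: |\operatorname{Im} z|<\varepsilon\}$ with $\varepsilon>0$, the extension being $2\pi$-periodic on it. -/

import Mathlib

open scoped Matrix ComplexOrder

noncomputable section

/-- The CPTP constraints on the pair `(A, B)` of complex matrices defining the Gaussian channel
`Γ ↦ A + B Γ Bᴴ` in one momentum sector: `Aᴴ A + B Bᴴ ≤ I` and `Bᴴ B ≤ I` in the Loewner order. -/
def SatisfiesCPTP {ι : Type*} [Fintype ι] [DecidableEq ι] (A B : Matrix ι ι ℂ) : Prop :=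
  (1 - (Aᴴ * A + B * Bᴴ)).PosSemidef ∧ (1 - Bᴴ * B).PosSemidef

/-- The preserved subspace `V_u` of `B`: the span of all (right) eigenvectors of `B` whose
eigenvalue has modulus one. -/
def preservedSubspace {ι : Type*} [Fintype ι] [DecidableEq ι] (B : Matrix ι ι ℂ) :
    Submodule ℂ (EuclideanSpace ℂ ι) :=
  Submodule.span ℂ {v | ∃ b : ℂ, ‖b‖ = 1 ∧ Matrix.toEuclideanLin B v = b • v}

/-- The matrix, in the standard basis, of the Hermitian (orthogonal) projector onto `V_u`. -/
def preservedProjector {ι : Type*} [Fintype ι] [DecidableEq ι] (B : Matrix ι ι ℂ) :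
    Matrix ι ι ℂ :=
  Matrix.toEuclideanLin.symm ((preservedSubspace B).starProjection).toLinearMap

/-- A Hermitian projector: a Hermitian idempotent matrix. -/
def IsHermitianProjector {ι : Type*} [Fintype ι] (P : Matrix ι ι ℂ) : Prop :=
  P.IsHermitian ∧ P * P = P

end

/-!
For a contraction `B`, the subspaces of vectors whose norm `Bⁿ` preserves are the kernels of the
positive semidefinite matrices `1 - (Bⁿ)ᴴ Bⁿ`; they decrease with `n` and are stationary from the
dimension `N` on. The last one is mapped isometrically into itself by `B`, so it is the preserved
subspace: `preservedSubspace_eq_powDefectKer`. Hence the preserved subspaces are the kernels of the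
real-analytic family of Hermitian matrices
`H k = 1 - (B k ^ N)ᴴ (B k ^ N)`.

Let `d` be the least index such that the coefficient `c k` of `Xᵈ` in the characteristic polynomial
of `H k` is not identically zero in `k`. Then the characteristic polynomial is `Xᵈ q k` with
`q k` evaluating to `c k` at `0`. Where `c k ≠ 0`, that is off isolated points, the kernel has
dimension `d`. For all `k`, the Cayley–Hamilton theorem gives `(q k)(H k) = c k • P k`, where `P k`
is the projector onto the kernel (`Matrix.IsHermitian.sum_charpoly_coeff_smul_pow`). So the entries
of `P` are quotients of real-analytic functions, and being bounded they have only removable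
singularities. Filling these in gives a real-analytic family `Q` that equals `P` off isolated points
(`exists_entrywiseAnalytic_eventuallyEq_preservedProjector`). By continuity `Q k` is a Hermitian
projector with `H k * Q k = 0`, so `P k * Q k = Q k` and `P k - Q k` is a Hermitian projector too.

Finally, the local power series of a real-analytic function on the line glue, by the identity
theorem, to a holomorphic function on a neighbourhood of the line. For a periodic function
compactness of a period gives a uniform radius, and the neighbourhood becomes a strip
(`AnalyticOnNhd.exists_complex_extension_strip`).
-/

/-! ### Vectors whose norm is preserved by the powers of a contraction -/

namespace Matrix

variable {ι : Type*} [Fintype ι]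

theorem PosSemidef.add_mulVec_eq_zero_iff {A C : Matrix ι ι ℂ} (hA : A.PosSemidef)
    (hC : C.PosSemidef) (x : ι → ℂ) : (A + C) *ᵥ x = 0 ↔ A *ᵥ x = 0 ∧ C *ᵥ x = 0 := by
  rw [← hA.dotProduct_mulVec_zero_iff, ← hC.dotProduct_mulVec_zero_iff,
    ← (hA.add hC).dotProduct_mulVec_zero_iff, add_mulVec, dotProduct_add]
  exact add_eq_zero_iff_of_nonneg (hA.dotProduct_mulVec_nonneg x) (hC.dotProduct_mulVec_nonneg x)

theorem PosSemidef.conjTranspose_mul_mul_mulVec_eq_zero_iff {C : Matrix ι ι ℂ}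
    (hC : C.PosSemidef) (B : Matrix ι ι ℂ) (x : ι → ℂ) :
    (Bᴴ * C * B) *ᵥ x = 0 ↔ C *ᵥ (B *ᵥ x) = 0 := by
  refine ⟨fun h => ?_, fun h => ?_⟩
  · rw [← hC.dotProduct_mulVec_zero_iff, star_mulVec, ← dotProduct_mulVec, mulVec_mulVec,
      mulVec_mulVec, h, dotProduct_zero]
  · rw [← mulVec_mulVec, ← mulVec_mulVec, h, mulVec_zero]

variable [DecidableEq ι]

/-- The defect `1 - (Bⁿ)ᴴ Bⁿ` of the `n`-th power of a matrix: for a contraction `B` it is positive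
semidefinite, and its kernel consists of the vectors whose norm `Bⁿ` preserves. -/
def powDefect (B : Matrix ι ι ℂ) (n : ℕ) : Matrix ι ι ℂ := 1 - (B ^ n)ᴴ * B ^ n

theorem powDefect_succ (B : Matrix ι ι ℂ) (n : ℕ) :
    powDefect B (n + 1) = powDefect B 1 + Bᴴ * powDefect B n * B := by
  simp only [powDefect, pow_succ, pow_zero, one_mul, conjTranspose_mul]
  noncomm_ring

theorem powDefect_isHermitian (B : Matrix ι ι ℂ) (n : ℕ) : (powDefect B n).IsHermitian := by
  simp [powDefect, IsHermitian]

theorem powDefect_posSemidef {B : Matrix ι ι ℂ} (hB : (powDefect B 1).PosSemidef) (n : ℕ) :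
    (powDefect B n).PosSemidef := by
  induction n with
  | zero => simpa [powDefect] using PosSemidef.zero
  | succ n ih => rw [powDefect_succ]; exact hB.add (ih.conjTranspose_mul_mul_same B)

/-- The kernel of the defect of `Bⁿ`. -/
noncomputable def powDefectKer (B : Matrix ι ι ℂ) (n : ℕ) : Submodule ℂ (EuclideanSpace ℂ ι) :=
  LinearMap.ker (toEuclideanLin (powDefect B n))

theorem mem_powDefectKer {B : Matrix ι ι ℂ} {n : ℕ} {v : EuclideanSpace ℂ ι} :
    v ∈ powDefectKer B n ↔ powDefect B n *ᵥ v.ofLp = 0 := by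
  rw [powDefectKer, LinearMap.mem_ker, toLpLin_apply]
  exact WithLp.toLp_eq_zero 2

theorem mem_powDefectKer_succ {B : Matrix ι ι ℂ} (hB : (powDefect B 1).PosSemidef) {n : ℕ}
    {v : EuclideanSpace ℂ ι} : v ∈ powDefectKer B (n + 1) ↔
      v ∈ powDefectKer B 1 ∧ toEuclideanLin B v ∈ powDefectKer B n := by
  simp only [mem_powDefectKer]
  rw [powDefect_succ, hB.add_mulVec_eq_zero_iff
    ((powDefect_posSemidef hB n).conjTranspose_mul_mul_same B),
    (powDefect_posSemidef hB n).conjTranspose_mul_mul_mulVec_eq_zero_iff]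
  rfl

theorem mem_powDefectKer_one {B : Matrix ι ι ℂ} {v : EuclideanSpace ℂ ι} :
    v ∈ powDefectKer B 1 ↔ (toEuclideanLin B).adjoint (toEuclideanLin B v) = v := by
  rw [mem_powDefectKer, ← toEuclideanLin_conjTranspose_eq_adjoint, toLpLin_apply,
    toLpLin_apply, powDefect, sub_mulVec, sub_eq_zero, pow_one, one_mulVec,
    ← mulVec_mulVec, eq_comm]
  exact ⟨fun h => congrArg (WithLp.toLp 2) h, fun h => congrArg WithLp.ofLp h⟩

theorem powDefectKer_succ_le {B : Matrix ι ι ℂ} (hB : (powDefect B 1).PosSemidef) (n : ℕ) :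
    powDefectKer B (n + 1) ≤ powDefectKer B n := by
  induction n with
  | zero => intro v _; simp [mem_powDefectKer, powDefect]
  | succ n ih =>
    intro v hv
    rw [mem_powDefectKer_succ hB] at hv ⊢
    exact ⟨hv.1, ih hv.2⟩

theorem powDefectKer_succ_eq_succ {B : Matrix ι ι ℂ} (hB : (powDefect B 1).PosSemidef) {n : ℕ}
    (h : powDefectKer B (n + 1) = powDefectKer B n) :
    powDefectKer B (n + 2) = powDefectKer B (n + 1) := by
  ext v
  rw [mem_powDefectKer_succ hB, h, ← mem_powDefectKer_succ hB, h]

/-- The decreasing chain of the subspaces on which `Bⁿ` is isometric is stationary from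
`n = card ι` on, because each strict inclusion costs a dimension. -/
theorem powDefectKer_card_succ {B : Matrix ι ι ℂ} (hB : (powDefect B 1).PosSemidef) :
    powDefectKer B (Fintype.card ι + 1) = powDefectKer B (Fintype.card ι) := by
  have key : ∀ n, powDefectKer B (n + 1) = powDefectKer B n ∨
      Module.finrank ℂ (powDefectKer B n) + n ≤ Fintype.card ι := by
    intro n
    induction n with
    | zero =>
      right
      simpa using Submodule.finrank_le (powDefectKer B 0)
    | succ n ih =>
      by_cases h : powDefectKer B (n + 1) = powDefectKer B n
      · exact Or.inl (powDefectKer_succ_eq_succ hB h)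
      · have := Submodule.finrank_lt_finrank_of_lt
          (lt_of_le_of_ne (powDefectKer_succ_le hB n) h)
        right
        have := ih.resolve_left h
        omega
  rcases key (Fintype.card ι) with h | h
  · exact h
  · have h0 : powDefectKer B (Fintype.card ι) = ⊥ := Submodule.finrank_eq_zero.1 (by omega)
    exact le_antisymm (powDefectKer_succ_le hB _) (h0 ▸ bot_le)

end Matrix

section Preserved

open Matrix

variable {ι : Type*} [Fintype ι] [DecidableEq ι]

/-! ### The preserved subspace as a kernel -/

theorem eigenvector_mem_powDefectKer {B : Matrix ι ι ℂ} (hB : (powDefect B 1).PosSemidef)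
    {v : EuclideanSpace ℂ ι} {b : ℂ} (hb : ‖b‖ = 1) (hv : toEuclideanLin B v = b • v) (n : ℕ) :
    v ∈ powDefectKer B n := by
  have h1 : v ∈ powDefectKer B 1 := by
    rw [mem_powDefectKer, ← hB.dotProduct_mulVec_zero_iff]
    have hv' : B *ᵥ v.ofLp = b • v.ofLp := congrArg WithLp.ofLp hv
    have hbb : star b * b = 1 := by
      simpa [hb] using Complex.conj_mul' b
    rw [powDefect, pow_one, sub_mulVec, dotProduct_sub, one_mulVec, ← mulVec_mulVec,
      dotProduct_mulVec, ← star_mulVec, hv', star_smul, smul_dotProduct, dotProduct_smul,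
      smul_smul, hbb, one_smul, sub_self]
  induction n with
  | zero => simp [mem_powDefectKer, powDefect]
  | succ n ih =>
    rw [mem_powDefectKer_succ hB, hv]
    exact ⟨h1, Submodule.smul_mem _ _ ih⟩

theorem adjoint_eigenvector {B : Matrix ι ι ℂ} (hB : (powDefect B 1).PosSemidef)
    {v : EuclideanSpace ℂ ι} {b : ℂ} (hb : ‖b‖ = 1) (hv : toEuclideanLin B v = b • v) :
    (toEuclideanLin B).adjoint v = star b • v := by
  have h := mem_powDefectKer_one.1 (eigenvector_mem_powDefectKer hB hb hv 1)
  rw [hv, map_smul] at h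
  have hbb : star b * b = 1 := by
    simpa [hb] using Complex.conj_mul' b
  rw [← one_smul ℂ ((toEuclideanLin B).adjoint v), ← hbb, ← smul_smul, h]

/-- The preserved subspace of a contraction is the kernel of `1 - (Bᴺ)ᴴ Bᴺ`, where `N` is the
dimension. On that kernel `B` is an isometry into itself, and the part of the kernel orthogonal to
the unimodular eigenvectors is again invariant, so it would contain one if it were nonzero. -/
theorem preservedSubspace_eq_powDefectKer {B : Matrix ι ι ℂ} (hB : (powDefect B 1).PosSemidef) :
    preservedSubspace B = powDefectKer B (Fintype.card ι) := by
  set T := toEuclideanLin B with hT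
  set K := powDefectKer B (Fintype.card ι) with hK
  have hle : preservedSubspace B ≤ K := by
    refine Submodule.span_le.2 ?_
    rintro v ⟨b, hb, hv⟩
    exact eigenvector_mem_powDefectKer hB hb hv _
  have hKmem : ∀ v ∈ K, v ∈ powDefectKer B 1 ∧ T v ∈ K := by
    intro v hv
    rwa [hK, ← powDefectKer_card_succ hB, mem_powDefectKer_succ hB] at hv
  have horth : ∀ v ∈ (preservedSubspace B)ᗮ, T v ∈ (preservedSubspace B)ᗮ := by
    intro v hv
    rw [Submodule.mem_orthogonal]
    intro w hw
    induction hw using Submodule.span_induction with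
    | mem w hw =>
      obtain ⟨b, hb, hw'⟩ := hw
      rw [← LinearMap.adjoint_inner_left, hT, adjoint_eigenvector hB hb hw', inner_smul_left,
        (Submodule.mem_orthogonal _ _).1 hv w (Submodule.subset_span ⟨b, hb, hw'⟩), mul_zero]
    | zero => simp
    | add x y _ _ hx hy => rw [inner_add_left, hx, hy, add_zero]
    | smul a x _ hx => rw [inner_smul_left, hx, mul_zero]
  have hbot : (preservedSubspace B)ᗮ ⊓ K = ⊥ := by
    by_contra hne
    set L := (preservedSubspace B)ᗮ ⊓ K
    have hL : ∀ v ∈ L, T v ∈ L := fun v hv => ⟨horth v hv.1, (hKmem v hv.2).2⟩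
    have : Nontrivial L := Submodule.nontrivial_iff_ne_bot.2 hne
    obtain ⟨b, hb⟩ := Module.End.exists_eigenvalue (T.restrict hL)
    obtain ⟨v, hv⟩ := hb.exists_hasEigenvector
    have hv1 : T v = b • (v : EuclideanSpace ℂ ι) := congrArg Subtype.val hv.apply_eq_smul
    have hv0 : (v : EuclideanSpace ℂ ι) ≠ 0 := fun h => hv.2 (Subtype.ext h)
    have hnorm : ‖T v‖ = ‖(v : EuclideanSpace ℂ ι)‖ := by
      have h := mem_powDefectKer_one.1 (hKmem v v.2.2).1
      have h2 : inner ℂ (T v) (T v) = inner ℂ (v : EuclideanSpace ℂ ι) v := by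
        rw [← LinearMap.adjoint_inner_right, h]
      rw [@norm_eq_sqrt_re_inner ℂ, h2, ← @norm_eq_sqrt_re_inner ℂ]
    have hb1 : ‖b‖ = 1 := by
      rw [hv1, norm_smul] at hnorm
      exact (mul_eq_right₀ (norm_ne_zero_iff.2 hv0)).1 hnorm
    have hmem : (v : EuclideanSpace ℂ ι) ∈ preservedSubspace B :=
      Submodule.subset_span ⟨b, hb1, hv1⟩
    exact hv0 (inner_self_eq_zero.1 ((Submodule.mem_orthogonal _ _).1 v.2.1 _ hmem))
  have := Submodule.sup_orthogonal_inf_of_hasOrthogonalProjection hle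
  rwa [hbot, sup_bot_eq] at this

/-! ### The preserved projector -/

theorem toEuclideanLin_preservedProjector (B : Matrix ι ι ℂ) :
    toEuclideanLin (preservedProjector B) =
      ((preservedSubspace B).starProjection).toLinearMap := by
  rw [preservedProjector, LinearEquiv.apply_symm_apply]

theorem preservedProjector_mulVec (B : Matrix ι ι ℂ) (x : ι → ℂ) :
    preservedProjector B *ᵥ x =
      ((preservedSubspace B).starProjection (WithLp.toLp 2 x)).ofLp :=
  congrArg WithLp.ofLp
    (LinearMap.congr_fun (toEuclideanLin_preservedProjector B) (WithLp.toLp 2 x))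

theorem isHermitianProjector_preservedProjector (B : Matrix ι ι ℂ) :
    IsHermitianProjector (preservedProjector B) := by
  refine ⟨?_, ?_⟩
  · rw [← isSymmetric_toEuclideanLin_iff, toEuclideanLin_preservedProjector]
    exact (preservedSubspace B).starProjection_isSymmetric
  · refine ext_of_mulVec_single fun i => ?_
    rw [← mulVec_mulVec]
    simp only [preservedProjector_mulVec]
    exact congrArg WithLp.ofLp
      ((Submodule.starProjection_eq_self_iff).2 (Submodule.starProjection_apply_mem _ _))

theorem norm_preservedProjector_apply_le (B : Matrix ι ι ℂ) (i j : ι) :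
    ‖preservedProjector B i j‖ ≤ 1 := by
  have h1 : preservedProjector B i j =
      ((preservedSubspace B).starProjection (EuclideanSpace.single j (1 : ℂ))).ofLp i := by
    have := congrFun (preservedProjector_mulVec B (Pi.single j 1)) i
    rwa [mulVec_single_one] at this
  rw [h1]
  calc _ ≤ ‖(preservedSubspace B).starProjection (EuclideanSpace.single j (1 : ℂ))‖ :=
        PiLp.norm_apply_le _ i
    _ ≤ ‖EuclideanSpace.single j (1 : ℂ)‖ := Submodule.norm_starProjection_apply_le _ _
    _ = 1 := by simp

theorem powDefect_mul_preservedProjector {B : Matrix ι ι ℂ} (hB : (powDefect B 1).PosSemidef) :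
    powDefect B (Fintype.card ι) * preservedProjector B = 0 := by
  refine ext_of_mulVec_single fun i => ?_
  rw [← mulVec_mulVec, preservedProjector_mulVec, zero_mulVec, ← mem_powDefectKer,
    ← preservedSubspace_eq_powDefectKer hB]
  exact Submodule.starProjection_apply_mem _ _

theorem preservedProjector_mul_of_powDefect_mul_eq_zero {B : Matrix ι ι ℂ}
    (hB : (powDefect B 1).PosSemidef) {M : Matrix ι ι ℂ}
    (hM : powDefect B (Fintype.card ι) * M = 0) : preservedProjector B * M = M := by
  refine ext_of_mulVec_single fun i => ?_
  have h : WithLp.toLp 2 (M *ᵥ Pi.single i 1) ∈ preservedSubspace B := by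
    rw [preservedSubspace_eq_powDefectKer hB, mem_powDefectKer, mulVec_mulVec, hM, zero_mulVec]
  rw [← mulVec_mulVec, preservedProjector_mulVec, Submodule.starProjection_eq_self_iff.2 h]

end Preserved

/-! ### Projector onto the kernel from the characteristic polynomial -/

namespace Matrix.IsHermitian

variable {ι : Type*} [Fintype ι] [DecidableEq ι] {H : Matrix ι ι ℂ}

theorem mul_eq_zero_of_pow_succ_mul_eq_zero (hH : H.IsHermitian) {M : Matrix ι ι ℂ}
    {n : ℕ} (h : H ^ (n + 1) * M = 0) : H * M = 0 := by
  induction n with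
  | zero => simpa using h
  | succ n ih =>
    refine ih ?_
    have h' : Hᴴ * H * (H ^ n * M) = 0 := by
      rw [hH.eq, ← h, pow_succ', pow_succ']
      simp only [mul_assoc]
    rw [conjTranspose_mul_self_mul_eq_zero] at h'
    rw [pow_succ', mul_assoc, h']

/-- If the characteristic polynomial of a Hermitian matrix `H` is `Xᵈ q`, then `q(H)` is `q(0)` times
the projector `P` onto the kernel of `H`: it maps into the kernel by the Cayley–Hamilton theorem,
and acts there as `q(0)`. The identity also holds when `q(0) = 0`. -/
theorem aeval_eq_coeff_zero_smul_of_charpoly_eq (hH : H.IsHermitian) {P : Matrix ι ι ℂ}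
    (hP : P.IsHermitian) (hHP : H * P = 0) (hfix : ∀ M, H * M = 0 → P * M = M)
    {d : ℕ} {q : Polynomial ℂ} (hq : H.charpoly = Polynomial.X ^ d * q) :
    Polynomial.aeval H q = q.coeff 0 • P := by
  have hCH : H ^ d * Polynomial.aeval H q = 0 := by
    have := aeval_self_charpoly H
    rwa [hq, map_mul, map_pow, Polynomial.aeval_X] at this
  have h0 : H * Polynomial.aeval H q = 0 := by
    cases d with
    | zero => rw [pow_zero, one_mul] at hCH; rw [hCH, mul_zero]
    | succ n => exact hH.mul_eq_zero_of_pow_succ_mul_eq_zero hCH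
  have hPH : P * H = 0 := by
    rw [← conjTranspose_eq_zero, conjTranspose_mul, hP.eq, hH.eq, hHP]
  rw [← hfix _ h0]
  conv_lhs => rw [← Polynomial.X_mul_divX_add q]
  rw [map_add, map_mul, Polynomial.aeval_X, Polynomial.aeval_C, mul_add, ← mul_assoc, hPH,
    zero_mul, zero_add, Algebra.algebraMap_eq_smul_one, mul_smul_comm, mul_one]

theorem sum_charpoly_coeff_smul_pow (hH : H.IsHermitian) {P : Matrix ι ι ℂ}
    (hP : P.IsHermitian) (hHP : H * P = 0) (hfix : ∀ M, H * M = 0 → P * M = M)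
    {d : ℕ} (hd : ∀ j < d, H.charpoly.coeff j = 0) :
    ∑ j ∈ Finset.range (Fintype.card ι + 1), H.charpoly.coeff (j + d) • H ^ j =
      H.charpoly.coeff d • P := by
  obtain ⟨q, hq⟩ := Polynomial.X_pow_dvd_iff.2 hd
  have hcoeff : ∀ j, H.charpoly.coeff (j + d) = q.coeff j := fun j => by
    rw [hq, Polynomial.coeff_X_pow_mul]
  have hdeg : q.natDegree < Fintype.card ι + 1 := by
    rw [Nat.lt_succ_iff, Polynomial.natDegree_le_iff_coeff_eq_zero]
    intro j hj
    rw [← hcoeff]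
    refine Polynomial.coeff_eq_zero_of_natDegree_lt ?_
    rw [charpoly_natDegree_eq_dim]
    omega
  have h := hH.aeval_eq_coeff_zero_smul_of_charpoly_eq hP hHP hfix hq
  rw [Polynomial.aeval_eq_sum_range' hdeg, ← hcoeff, zero_add] at h
  rw [← h]
  exact Finset.sum_congr rfl fun j _ => by rw [hcoeff]

theorem finrank_ker_eq_of_charpoly_coeff (hH : H.IsHermitian) {d : ℕ}
    (hd : ∀ j < d, H.charpoly.coeff j = 0) (hd' : H.charpoly.coeff d ≠ 0) :
    Module.finrank ℂ (LinearMap.ker (toEuclideanLin H)) = d := by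
  have h1 := LinearMap.finrank_maxGenEigenspace_zero_eq (toEuclideanLin H)
  rw [((isSymmetric_toEuclideanLin_iff.2 hH).isFinitelySemisimple).maxGenEigenspace_eq_eigenspace,
    Module.End.eigenspace_zero] at h1
  have h2 : (toEuclideanLin H).charpoly = H.charpoly := by
    rw [show toEuclideanLin H = _ from LinearEquiv.congr_fun (toLpLin_eq_toLin 2 2) H,
      Matrix.charpoly_toLin]
  rw [h1, h2]
  refine le_antisymm (Polynomial.natTrailingDegree_le_of_ne_zero hd') ?_
  exact Polynomial.le_natTrailingDegree (charpoly_monic H).ne_zero hd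

end Matrix.IsHermitian

/-! ### Isolated singularities on the real line -/

section RealLine

open Filter Topology

/-- A bounded function `P` with `c P` analytic, for `c` analytic and not vanishing near `x` except
possibly at `x`, has a removable singularity at `x`: it is meromorphic there and does not tend to
infinity. -/
theorem exists_analyticAt_eventuallyEq_of_bounded {c R P : ℝ → ℂ} {x : ℝ} {C : ℝ}
    (hc : AnalyticAt ℝ c x) (hR : AnalyticAt ℝ R x) (h : ∀ y, R y = c y * P y)
    (hne : ∀ᶠ y in 𝓝[≠] x, c y ≠ 0) (hP : ∀ y, ‖P y‖ ≤ C) :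
    ∃ g : ℝ → ℂ, AnalyticAt ℝ g x ∧ P =ᶠ[𝓝[≠] x] g := by
  have hm : MeromorphicAt P x := by
    have h1 : MeromorphicAt (c⁻¹ * R) x := hc.meromorphicAt.inv.mul hR.meromorphicAt
    refine h1.congr ?_
    filter_upwards [hne] with y hy
    simp [h, hy]
  refine (MeromorphicAt.meromorphicOrderAt_nonneg_iff hm).1 (not_lt.1 fun hlt => ?_)
  have ht := tendsto_norm_cobounded_atTop.comp (tendsto_cobounded_of_meromorphicOrderAt_neg hlt)
  obtain ⟨y, hy⟩ := (ht.eventually_gt_atTop C).exists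
  exact absurd (hP y) (not_le.2 hy)

/-- If a property fails only at isolated points of `ℝ`, it fails at only finitely many points of
each bounded interval. -/
theorem finite_setOf_not_of_eventually_nhdsNE {p : ℝ → Prop}
    (hp : ∀ x, ∀ᶠ y in 𝓝[≠] x, p y) (a b : ℝ) : {k ∈ Set.Icc a b | ¬ p k}.Finite := by
  refine isCompact_Icc.induction_on (p := fun s => {k ∈ s | ¬ p k}.Finite) (by simp)
    (fun s t hst ht => ht.subset fun k hk => ⟨hst hk.1, hk.2⟩)
    (fun s t hs ht => (hs.union ht).subset fun k hk => hk.1.imp (⟨·, hk.2⟩) (⟨·, hk.2⟩))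
    fun x _ => ?_
  refine ⟨{y | y ≠ x → p y}, mem_nhdsWithin_of_mem_nhds (eventually_nhdsWithin_iff.1 (hp x)), ?_⟩
  refine (Set.finite_singleton x).subset fun k hk => ?_
  by_contra hne
  exact hk.2 (hk.1 hne)

theorem AnalyticOnNhd.eventually_ne_zero_nhdsNE {c : ℝ → ℂ} (hc : AnalyticOnNhd ℝ c Set.univ)
    {x₀ : ℝ} (h₀ : c x₀ ≠ 0) (x : ℝ) : ∀ᶠ y in 𝓝[≠] x, c y ≠ 0 := by
  by_contra h
  exact h₀ (hc.eqOn_zero_of_preconnected_of_frequently_eq_zero isPreconnected_univ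
    (Set.mem_univ x) ((not_eventually.1 h).mono fun _ => not_not.1) (Set.mem_univ x₀))

/-- Two functions continuous at `x` that agree near `x` except possibly at
`x` agree at `x`. -/
theorem ContinuousAt.eq_of_eventuallyEq_nhdsNE {E : Type*} [TopologicalSpace E] [T2Space E]
    {f g : ℝ → E} {x : ℝ} (hf : ContinuousAt f x) (hg : ContinuousAt g x)
    (h : f =ᶠ[𝓝[≠] x] g) : f x = g x :=
  tendsto_nhds_unique (hf.tendsto.mono_left nhdsWithin_le_nhds |>.congr' h)
    (hg.tendsto.mono_left nhdsWithin_le_nhds)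

/-- Local analytic corrections of a function at isolated points glue to a global analytic
function, because each of them is determined by continuity. -/
theorem exists_analyticOnNhd_eventuallyEq {P : ℝ → ℂ}
    (h : ∀ x, ∃ g : ℝ → ℂ, AnalyticAt ℝ g x ∧ P =ᶠ[𝓝[≠] x] g) :
    ∃ Q : ℝ → ℂ, AnalyticOnNhd ℝ Q Set.univ ∧ ∀ x, P =ᶠ[𝓝[≠] x] Q := by
  choose g hg hPg using h
  have key : ∀ x, (fun y => g y y) =ᶠ[𝓝 x] g x := by
    intro x
    filter_upwards [(hg x).eventually_analyticAt,
      eventually_eventually_nhds.2 (eventually_nhdsWithin_iff.1 (hPg x))] with y hy hPy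
    rcases eq_or_ne y x with rfl | hyx
    · rfl
    refine (hg y).continuousAt.eq_of_eventuallyEq_nhdsNE hy.continuousAt ?_
    have hne : ∀ᶠ z in 𝓝[≠] y, z ≠ x := nhdsWithin_le_nhds (eventually_ne_nhds hyx)
    filter_upwards [hPg y, nhdsWithin_le_nhds hPy, hne] with z h1 h2 h3
    rw [← h1, h2 h3]
  exact ⟨fun y => g y y, fun x _ => (hg x).congr (key x).symm,
    fun x => (hPg x).trans ((key x).symm.filter_mono nhdsWithin_le_nhds)⟩

/-! ### Complex extension of real-analytic functions -/

theorem tendsto_ofReal_nhdsNE (x : ℝ) :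
    Tendsto (fun t : ℝ => (t : ℂ)) (𝓝[≠] x) (𝓝[≠] (x : ℂ)) := by
  refine tendsto_nhdsWithin_iff.2
    ⟨Complex.continuous_ofReal.continuousAt.tendsto.mono_left nhdsWithin_le_nhds, ?_⟩
  filter_upwards [self_mem_nhdsWithin] with t ht h
  exact ht (Complex.ofReal_injective h)

section Complexification

variable {E : Type*} [NormedAddCommGroup E] [NormedSpace ℂ E]

/-- Holomorphic extensions of one function `f` on the real line to balls with real centres glue
to a holomorphic function on the union of the balls. Two such balls that meet overlap in a convex
set containing a real point, so the identity theorem applies. -/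
theorem exists_analyticOnNhd_iUnion_ball {f : ℝ → E} {r : ℝ → ℝ} {G : ℝ → ℂ → E}
    (hG : ∀ x : ℝ, AnalyticOnNhd ℂ (G x) (Metric.ball (x : ℂ) (r x)))
    (hf : ∀ x y : ℝ, (y : ℂ) ∈ Metric.ball (x : ℂ) (r x) → G x y = f y) :
    ∃ F : ℂ → E, AnalyticOnNhd ℂ F (⋃ x : ℝ, Metric.ball (x : ℂ) (r x)) ∧
      ∀ y : ℝ, (y : ℂ) ∈ (⋃ x : ℝ, Metric.ball (x : ℂ) (r x)) → F y = f y := by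
  classical
  have agree : ∀ (x x' : ℝ) (z : ℂ), z ∈ Metric.ball (x : ℂ) (r x) →
      z ∈ Metric.ball (x' : ℂ) (r x') → G x z = G x' z := by
    intro x x' z hz hz'
    set V := Metric.ball (x : ℂ) (r x) ∩ Metric.ball (x' : ℂ) (r x') with hV
    have hre : ∀ (t s : ℝ), z ∈ Metric.ball (t : ℂ) s → (z.re : ℂ) ∈ Metric.ball (t : ℂ) s := by
      intro t s ht
      rw [Metric.mem_ball, dist_eq_norm] at ht ⊢
      refine lt_of_le_of_lt ?_ ht
      rw [← Complex.ofReal_sub, Complex.norm_real]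
      simpa using Complex.abs_re_le_norm (z - t)
    have hw : (z.re : ℂ) ∈ V := ⟨hre _ _ hz, hre _ _ hz'⟩
    have hVo : IsOpen V := Metric.isOpen_ball.inter Metric.isOpen_ball
    have hVc : IsPreconnected V :=
      ((convex_ball _ _).inter (convex_ball _ _)).isPreconnected
    have hfreq : ∃ᶠ w in 𝓝[≠] (z.re : ℂ), G x w = G x' w := by
      refine (tendsto_ofReal_nhdsNE z.re).frequently (Eventually.frequently ?_)
      filter_upwards [nhdsWithin_le_nhds
        (Complex.continuous_ofReal.continuousAt.preimage_mem_nhds (hVo.mem_nhds hw))] with t ht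
      rw [hf x t ht.1, hf x' t ht.2]
    exact ((hG x).mono Set.inter_subset_left).eqOn_of_preconnected_of_frequently_eq
      ((hG x').mono Set.inter_subset_right) hVc hw hfreq ⟨hz, hz'⟩
  let F : ℂ → E := fun z =>
    if h : ∃ x : ℝ, z ∈ Metric.ball (x : ℂ) (r x) then G h.choose z else 0
  have hF : ∀ x : ℝ, ∀ z ∈ Metric.ball (x : ℂ) (r x), F z = G x z := by
    intro x z hz
    have h : ∃ x : ℝ, z ∈ Metric.ball (x : ℂ) (r x) := ⟨x, hz⟩
    simp only [F, dif_pos h]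
    exact agree _ _ _ h.choose_spec hz
  refine ⟨F, fun z hz => ?_, fun y hy => ?_⟩
  · obtain ⟨x, hx⟩ := Set.mem_iUnion.1 hz
    refine (hG x z hx).congr ?_
    filter_upwards [Metric.isOpen_ball.mem_nhds hx] with w hw using (hF x w hw).symm
  · obtain ⟨x, hx⟩ := Set.mem_iUnion.1 hy
    rw [hF x _ hx, hf x y hx]

variable [NormedSpace ℝ E] [IsScalarTower ℝ ℂ E] [CompleteSpace E]

/-- A real-analytic function extends holomorphically to a complex ball around each real point:
the same power series coefficients are used with a complex variable. -/
theorem AnalyticAt.exists_complex_extension_ball {f : ℝ → E} {x : ℝ}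
    (hf : AnalyticAt ℝ f x) :
    ∃ r > 0, ∃ F : ℂ → E, AnalyticOnNhd ℂ F (Metric.ball (x : ℂ) r) ∧
      ∀ y : ℝ, (y : ℂ) ∈ Metric.ball (x : ℂ) r → F y = f y := by
  obtain ⟨p, ρ, hp⟩ := hf
  obtain ⟨r, hr0, hr⟩ := ENNReal.lt_iff_exists_nnreal_btwn.1 hp.r_pos
  have hr0' : 0 < r := by exact_mod_cast hr0
  set q : FormalMultilinearSeries ℂ ℂ E := fun n =>
    ContinuousMultilinearMap.mkPiRing ℂ (Fin n) (p.coeff n) with hq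
  have hnorm : ∀ n, ‖q n‖ = ‖p n‖ := fun n => by
    rw [p.norm_apply_eq_norm_coef]
    exact ContinuousMultilinearMap.norm_mkPiRing _
  have hrad : (r : ENNReal) ≤ q.radius := by
    obtain ⟨C, -, hC⟩ := p.norm_mul_pow_le_of_lt_radius (hr.trans_le hp.r_le)
    exact q.le_radius_of_bound C fun n => by rw [hnorm]; exact hC n
  have hrpos : (0 : ENNReal) < r := hr0
  have hqb := (q.hasFPowerSeriesOnBall (hrpos.trans_le hrad)).mono hrpos hrad
  refine ⟨r, hr0', fun z => q.sum (z - x), ?_, ?_⟩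
  · have h1 := (hqb.comp_sub (x : ℂ)).analyticOnNhd
    rwa [zero_add, Metric.eball_coe] at h1
  · intro y hy
    have hyr : ‖y - x‖ < r := by
      rw [Metric.mem_ball, dist_eq_norm, ← Complex.ofReal_sub, Complex.norm_real] at hy
      exact hy
    have hy1 : (y - x : ℝ) ∈ Metric.eball (0 : ℝ) ρ := by
      refine Metric.eball_subset_eball hr.le ?_
      rw [Metric.eball_coe]
      simpa using hyr
    have hy2 : ((y : ℂ) - x) ∈ Metric.eball (0 : ℂ) r := by
      rw [Metric.eball_coe, mem_ball_zero_iff, ← Complex.ofReal_sub, Complex.norm_real]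
      exact hyr
    have hs1 := hp.hasSum hy1
    have hs2 := hqb.hasSum hy2
    rw [add_sub_cancel] at hs1
    rw [zero_add] at hs2
    have hterm : ∀ n, q n (fun _ => (y : ℂ) - x) = p n (fun _ => y - x) := fun n => by
      rw [p.apply_eq_pow_smul_coeff, hq, ContinuousMultilinearMap.mkPiRing_apply,
        Finset.prod_const, Finset.card_univ, Fintype.card_fin, ← Complex.ofReal_sub,
        ← Complex.ofReal_pow, ← Complex.coe_algebraMap, algebraMap_smul]
    simp only [hterm] at hs2
    exact hs2.unique hs1

/-- A real-analytic function on the line extends holomorphically to an open neighbourhood of the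
line. -/
theorem AnalyticOnNhd.exists_complex_extension {f : ℝ → E} (hf : AnalyticOnNhd ℝ f Set.univ) :
    ∃ (U : Set ℂ) (F : ℂ → E), IsOpen U ∧ (∀ x : ℝ, (x : ℂ) ∈ U) ∧ AnalyticOnNhd ℂ F U ∧
      ∀ x : ℝ, F x = f x := by
  choose r hr G hG hGf using fun x => (hf x (Set.mem_univ x)).exists_complex_extension_ball
  obtain ⟨F, hF, hFf⟩ := exists_analyticOnNhd_iUnion_ball hG hGf
  have hmem : ∀ x : ℝ, (x : ℂ) ∈ ⋃ x : ℝ, Metric.ball (x : ℂ) (r x) := fun x =>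
    Set.mem_iUnion.2 ⟨x, Metric.mem_ball_self (hr x)⟩
  exact ⟨_, F, isOpen_iUnion fun _ => Metric.isOpen_ball, hmem, hF, fun x => hFf x (hmem x)⟩

/-- A periodic real-analytic function on the line extends to a periodic holomorphic function on a
strip: by compactness of a period, the local extensions exist on balls of one radius. -/
theorem AnalyticOnNhd.exists_complex_extension_strip {f : ℝ → E} {T : ℝ}
    (hf : AnalyticOnNhd ℝ f Set.univ) (hT : 0 < T) (hfT : Function.Periodic f T) :
    ∃ (ε : ℝ) (F : ℂ → E), 0 < ε ∧ AnalyticOnNhd ℂ F {z : ℂ | |z.im| < ε} ∧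
      (∀ x : ℝ, F x = f x) ∧ ∀ z : ℂ, |z.im| < ε → F (z + T) = F z := by
  obtain ⟨U, F₀, hUo, hU, hF₀, hF₀f⟩ := hf.exists_complex_extension
  -- The neighbourhood contains `ε`-balls around the points of one period; translating by multiples
  -- of `T` gives extensions of radius `ε` everywhere.
  obtain ⟨ε, hε, hεU⟩ := (isCompact_Icc (a := (0 : ℝ)) (b := T)).image
    Complex.continuous_ofReal |>.exists_thickening_subset_open hUo (by
      rintro _ ⟨x, -, rfl⟩; exact hU x)
  have hball : ∀ x : ℝ, ∃ G : ℂ → E, AnalyticOnNhd ℂ G (Metric.ball (x : ℂ) ε) ∧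
      ∀ y : ℝ, (y : ℂ) ∈ Metric.ball (x : ℂ) ε → G y = f y := by
    intro x
    obtain ⟨n, hn, -⟩ := existsUnique_sub_zsmul_mem_Ico hT x 0
    rw [zero_add] at hn
    have hn' : x - n • T ∈ Set.Icc 0 T := Set.Ico_subset_Icc_self hn
    refine ⟨fun z => F₀ (z - (n • T : ℝ)), fun z hz => ?_, fun y _ => ?_⟩
    · have hz' : z - (n • T : ℝ) ∈ U := by
        refine hεU (Metric.mem_thickening_iff.2 ⟨_, ⟨_, hn', rfl⟩, ?_⟩)
        rw [Metric.mem_ball] at hz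
        rwa [Complex.ofReal_sub, dist_sub_right]
      exact (hF₀ _ hz').comp_of_eq (by fun_prop) rfl
    · simp only
      rw [← Complex.ofReal_sub, hF₀f, hfT.sub_zsmul_eq]
  choose G hG hGf using hball
  have hstrip : (⋃ x : ℝ, Metric.ball (x : ℂ) ε) = {z : ℂ | |z.im| < ε} := by
    ext z
    simp only [Set.mem_iUnion, Metric.mem_ball, dist_eq_norm, Set.mem_ofPred_eq]
    refine ⟨fun ⟨x, hx⟩ => lt_of_le_of_lt ?_ hx, fun hz => ⟨z.re, ?_⟩⟩
    · simpa using Complex.abs_im_le_norm (z - x)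
    · have : z - z.re = z.im * Complex.I := by
        apply Complex.ext <;> simp
      simpa [this] using hz
  obtain ⟨F, hF, hFf⟩ := exists_analyticOnNhd_iUnion_ball hG hGf
  rw [hstrip] at hF hFf
  have hFr : ∀ x : ℝ, F x = f x := fun x => hFf x (by simpa using hε)
  refine ⟨ε, F, hε, hF, hFr, fun z hz => ?_⟩
  have hc : IsPreconnected {z : ℂ | |z.im| < ε} := by
    have : {z : ℂ | |z.im| < ε} = Complex.imLm ⁻¹' Set.Ioo (-ε) ε := by
      ext z; simp [abs_lt]
    rw [this]
    exact ((convex_Ioo _ _).linear_preimage Complex.imLm).isPreconnected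
  have hshift : AnalyticOnNhd ℂ (fun z => F (z + T)) {z : ℂ | |z.im| < ε} := fun w hw =>
    (hF (w + T) (by simpa using hw)).comp_of_eq (by fun_prop) rfl
  refine hshift.eqOn_of_preconnected_of_frequently_eq hF hc (z₀ := ((0 : ℝ) : ℂ))
    (by simpa using hε) ?_ hz
  refine (tendsto_ofReal_nhdsNE 0).frequently (Eventually.frequently
    (Eventually.of_forall fun t => ?_))
  rw [← Complex.ofReal_add, hFr, hFr, hfT]

end Complexification

end RealLine

/-! ### Analytic families of matrices -/

section Families

open Filter Topology Matrix

section EntrywiseAnalytic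

variable {ι : Type*}

/-- A family of matrices is entrywise real-analytic in its parameter. -/
def EntrywiseAnalytic (M : ℝ → Matrix ι ι ℂ) : Prop :=
  ∀ i j, AnalyticOnNhd ℝ (fun k => M k i j) Set.univ

namespace EntrywiseAnalytic

variable {M M' : ℝ → Matrix ι ι ℂ}

theorem const (M₀ : Matrix ι ι ℂ) : EntrywiseAnalytic fun _ => M₀ :=
  fun _ _ => analyticOnNhd_const

theorem sub (hM : EntrywiseAnalytic M) (hM' : EntrywiseAnalytic M') :
    EntrywiseAnalytic fun k => M k - M' k :=
  fun i j => (hM i j).sub (hM' i j)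

theorem conjTranspose (hM : EntrywiseAnalytic M) : EntrywiseAnalytic fun k => (M k)ᴴ :=
  fun i j x hx => (Complex.conjCLE.toContinuousLinearMap.analyticAt _).comp (hM j i x hx)

theorem continuous (hM : EntrywiseAnalytic M) : Continuous M :=
  continuous_matrix fun i j => continuousOn_univ.1 (hM i j).continuousOn

theorem smul {c : ℝ → ℂ} (hc : AnalyticOnNhd ℝ c Set.univ) (hM : EntrywiseAnalytic M) :
    EntrywiseAnalytic fun k => c k • M k :=
  fun i j => hc.mul (hM i j)

theorem sum {α : Type*} {s : Finset α} {M : α → ℝ → Matrix ι ι ℂ}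
    (hM : ∀ a ∈ s, EntrywiseAnalytic (M a)) : EntrywiseAnalytic fun k => ∑ a ∈ s, M a k := by
  intro i j
  simp only [Matrix.sum_apply]
  exact s.analyticOnNhd_fun_sum fun a ha => hM a ha i j

variable [Fintype ι]

theorem mul (hM : EntrywiseAnalytic M) (hM' : EntrywiseAnalytic M') :
    EntrywiseAnalytic fun k => M k * M' k := by
  intro i j
  simp only [Matrix.mul_apply]
  exact Finset.univ.analyticOnNhd_fun_sum fun l _ => (hM i l).mul (hM' l j)

variable [DecidableEq ι]

theorem pow (hM : EntrywiseAnalytic M) (n : ℕ) : EntrywiseAnalytic fun k => M k ^ n := by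
  induction n with
  | zero => simpa using const 1
  | succ n ih => simpa only [pow_succ] using ih.mul hM

theorem powDefect (hM : EntrywiseAnalytic M) (n : ℕ) :
    EntrywiseAnalytic fun k => Matrix.powDefect (M k) n :=
  (const 1).sub ((hM.pow n).conjTranspose.mul (hM.pow n))

/-- The coefficients of the characteristic polynomial are universal polynomials in the entries. -/
theorem charpoly_coeff (hM : EntrywiseAnalytic M) (n : ℕ) :
    AnalyticOnNhd ℝ (fun k => (M k).charpoly.coeff n) Set.univ := by
  have h : ∀ k, (M k).charpoly.coeff n =
      MvPolynomial.aeval (fun p : ι × ι => M k p.1 p.2) ((charpoly.univ ℂ ι).coeff n) := fun k => by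
    have h1 := charpoly.univ_coeff_eval₂Hom ι (algebraMap ℂ ℂ) (fun p : ι × ι => M k p.1 p.2) n
    rw [MvPolynomial.aeval_def, ← MvPolynomial.coe_eval₂Hom, h1]
    congr 1
  simp only [h]
  exact AnalyticOnNhd.aeval_mvPolynomial (𝕜 := ℝ) (f := fun k (p : ι × ι) => M k p.1 p.2)
    (fun p => hM p.1 p.2) ((charpoly.univ ℂ ι).coeff n)

end EntrywiseAnalytic

end EntrywiseAnalytic

variable {ι : Type*} [Fintype ι] [DecidableEq ι]

/-- The lowest coefficient of the characteristic polynomial that does not vanish identically on an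
analytic family vanishes only at isolated points. For Hermitian matrices its index `d` is the
generic dimension of the kernel, and the zeros are the points where the kernel is larger. -/
theorem EntrywiseAnalytic.exists_charpoly_coeff_eventually_ne_zero {H : ℝ → Matrix ι ι ℂ}
    (hH : EntrywiseAnalytic H) : ∃ d, (∀ j < d, ∀ k, (H k).charpoly.coeff j = 0) ∧
      ∀ x, ∀ᶠ k in 𝓝[≠] x, (H k).charpoly.coeff d ≠ 0 := by
  classical
  have hex : ∃ d, ∃ k, (H k).charpoly.coeff d ≠ 0 := by
    refine ⟨(H 0).charpoly.natDegree, 0, ?_⟩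
    rw [Polynomial.coeff_natDegree]
    exact Polynomial.leadingCoeff_ne_zero.2 (charpoly_monic _).ne_zero
  obtain ⟨k₀, hk₀⟩ := Nat.find_spec hex
  refine ⟨Nat.find hex, fun j hj k => ?_, fun x => ?_⟩
  · by_contra h
    exact Nat.find_min hex hj ⟨k, h⟩
  · exact (hH.charpoly_coeff _).eventually_ne_zero_nhdsNE hk₀ x

variable {B : ℝ → Matrix ι ι ℂ}

theorem exists_eventually_finrank_preservedSubspace_eq (hB : EntrywiseAnalytic B)
    (hB1 : ∀ k, (powDefect (B k) 1).PosSemidef) :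
    ∃ d, ∀ x, ∀ᶠ k in 𝓝[≠] x, Module.finrank ℂ (preservedSubspace (B k)) = d := by
  obtain ⟨d, hlow, hd⟩ :=
    (hB.powDefect (Fintype.card ι)).exists_charpoly_coeff_eventually_ne_zero
  refine ⟨d, fun x => ?_⟩
  filter_upwards [hd x] with k hk
  rw [preservedSubspace_eq_powDefectKer (hB1 k)]
  exact (powDefect_isHermitian _ _).finrank_ker_eq_of_charpoly_coeff
    (fun j hj => hlow j hj k) hk

/-- Off isolated points, the preserved projector agrees with an analytic family of matrices. -/
theorem exists_entrywiseAnalytic_eventuallyEq_preservedProjector (hB : EntrywiseAnalytic B)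
    (hB1 : ∀ k, (powDefect (B k) 1).PosSemidef) :
    ∃ Q : ℝ → Matrix ι ι ℂ, EntrywiseAnalytic Q ∧
      ∀ x, (fun k => preservedProjector (B k)) =ᶠ[𝓝[≠] x] Q := by
  have hH := hB.powDefect (Fintype.card ι)
  obtain ⟨d, hlow, hd⟩ := hH.exists_charpoly_coeff_eventually_ne_zero
  have hR : EntrywiseAnalytic fun k => (powDefect (B k) (Fintype.card ι)).charpoly.coeff d •
      preservedProjector (B k) := by
    have h := EntrywiseAnalytic.sum (s := Finset.range (Fintype.card ι + 1))
      (M := fun j k => (powDefect (B k) (Fintype.card ι)).charpoly.coeff (j + d) •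
        powDefect (B k) (Fintype.card ι) ^ j)
      fun j _ => .smul (hH.charpoly_coeff (j + d)) (hH.pow j)
    have heq : ∀ k, _ := fun k =>
      (powDefect_isHermitian (B k) (Fintype.card ι)).sum_charpoly_coeff_smul_pow
        (isHermitianProjector_preservedProjector (B k)).1
        (powDefect_mul_preservedProjector (hB1 k))
        (fun _ => preservedProjector_mul_of_powDefect_mul_eq_zero (hB1 k))
        (fun j hj => hlow j hj k)
    simpa only [heq] using h
  have hloc : ∀ i j, ∃ Q : ℝ → ℂ, AnalyticOnNhd ℝ Q Set.univ ∧
      ∀ x, (fun k => preservedProjector (B k) i j) =ᶠ[𝓝[≠] x] Q := fun i j =>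
    exists_analyticOnNhd_eventuallyEq fun x =>
      exists_analyticAt_eventuallyEq_of_bounded (hH.charpoly_coeff d x (Set.mem_univ x))
        (hR i j x (Set.mem_univ x)) (fun _ => rfl) (hd x)
        fun k => norm_preservedProjector_apply_le (B k) i j
  choose Q hQ hPQ using hloc
  refine ⟨fun k => Matrix.of fun i j => Q i j k, hQ, fun x => ?_⟩
  filter_upwards [eventually_all.2 fun i => eventually_all.2 fun j => hPQ i j x] with k hk
  exact Matrix.ext hk

variable {Q : ℝ → Matrix ι ι ℂ}

theorem isHermitianProjector_of_eventuallyEq_preservedProjector (hQ : Continuous Q)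
    (hPQ : ∀ x, (fun k => preservedProjector (B k)) =ᶠ[𝓝[≠] x] Q) (k : ℝ) :
    IsHermitianProjector (Q k) := by
  refine ⟨?_, ?_⟩
  · refine ContinuousAt.eq_of_eventuallyEq_nhdsNE (f := fun k => (Q k)ᴴ)
      hQ.matrix_conjTranspose.continuousAt hQ.continuousAt ?_
    filter_upwards [hPQ k] with l hl
    rw [← hl, (isHermitianProjector_preservedProjector (B l)).1.eq]
  · refine ContinuousAt.eq_of_eventuallyEq_nhdsNE (f := fun k => Q k * Q k)
      (hQ.matrix_mul hQ).continuousAt hQ.continuousAt ?_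
    filter_upwards [hPQ k] with l hl
    rw [← hl, (isHermitianProjector_preservedProjector (B l)).2]

/-- The continuous continuation of the preserved projector is everywhere dominated by it, because
its range stays in the kernel that is the preserved subspace. So the difference is a projector. -/
theorem isHermitianProjector_preservedProjector_sub (hB : EntrywiseAnalytic B)
    (hB1 : ∀ k, (powDefect (B k) 1).PosSemidef) (hQ : Continuous Q)
    (hPQ : ∀ x, (fun k => preservedProjector (B k)) =ᶠ[𝓝[≠] x] Q) (k : ℝ) :
    IsHermitianProjector (preservedProjector (B k) - Q k) := by
  obtain ⟨hQh, hQ2⟩ := isHermitianProjector_of_eventuallyEq_preservedProjector hQ hPQ k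
  obtain ⟨hPh, hP2⟩ := isHermitianProjector_preservedProjector (B k)
  have hHQ : powDefect (B k) (Fintype.card ι) * Q k = 0 := by
    refine ContinuousAt.eq_of_eventuallyEq_nhdsNE
      (f := fun k => powDefect (B k) (Fintype.card ι) * Q k) (g := fun _ => 0)
      ((hB.powDefect _).continuous.matrix_mul hQ).continuousAt continuousAt_const ?_
    filter_upwards [hPQ k] with l hl
    rw [← hl, powDefect_mul_preservedProjector (hB1 l)]
  have hPQk := preservedProjector_mul_of_powDefect_mul_eq_zero (hB1 k) hHQ
  have hQPk : Q k * preservedProjector (B k) = Q k := by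
    have := congrArg conjTranspose hPQk
    rwa [conjTranspose_mul, hQh.eq, hPh.eq] at this
  refine ⟨hPh.sub hQh, ?_⟩
  rw [sub_mul, mul_sub, mul_sub, hP2, hPQk, hQPk, hQ2, sub_self, sub_zero]

theorem periodic_of_eventuallyEq_preservedProjector {T : ℝ} (hQ : Continuous Q)
    (hPQ : ∀ x, (fun k => preservedProjector (B k)) =ᶠ[𝓝[≠] x] Q) (hT : Function.Periodic B T) :
    Function.Periodic Q T := by
  intro x
  refine ContinuousAt.eq_of_eventuallyEq_nhdsNE (f := fun k => Q (k + T))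
    (hQ.comp (continuous_add_const T)).continuousAt hQ.continuousAt ?_
  have ht : Tendsto (fun k => k + T) (𝓝[≠] x) (𝓝[≠] (x + T)) :=
    tendsto_nhdsWithin_iff.2
      ⟨(continuous_add_const T).continuousAt.tendsto.mono_left nhdsWithin_le_nhds, by
        filter_upwards [self_mem_nhdsWithin] with k hk h using hk (add_right_cancel h)⟩
  filter_upwards [hPQ x, ht.eventually (hPQ (x + T))] with k h1 h2
  rw [← h1, ← h2, hT]

end Families

theorem lemma3p1 {ι : Type*} [Fintype ι] [DecidableEq ι]
    (A B : ℝ → Matrix ι ι ℂ)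
    (hA : ∀ i j, AnalyticOnNhd ℝ (fun k => A k i j) Set.univ)
    (hB : ∀ i j, AnalyticOnNhd ℝ (fun k => B k i j) Set.univ)
    (hAB : ∀ k, SatisfiesCPTP (A k) (B k)) :
    -- the dimension is constant up to finitely many momenta (in every bounded interval)
    (∃ d : ℕ, ∀ a b : ℝ,
      {k ∈ Set.Icc a b | Module.finrank ℂ (preservedSubspace (B k)) ≠ d}.Finite) ∧
    -- the projector is the sum of `Pt` and `Pd`, with `Pt` extended to the open set `U` by `F`
    ∃ (Pt Pd : ℝ → Matrix ι ι ℂ) (U : Set ℂ) (F : ℂ → Matrix ι ι ℂ),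
      (∀ k, preservedProjector (B k) = Pt k + Pd k) ∧
      (∀ k, IsHermitianProjector (Pt k)) ∧
      (∀ k, IsHermitianProjector (Pd k)) ∧
      (∀ a b : ℝ, {k ∈ Set.Icc a b | Pd k ≠ 0}.Finite) ∧
      IsOpen U ∧
      (∀ k : ℝ, (k : ℂ) ∈ U) ∧
      (∀ i j, AnalyticOnNhd ℂ (fun z => F z i j) U) ∧
      (∀ k : ℝ, F (k : ℂ) = Pt k) ∧
      -- when the momentum is an angle, everything lives on the circle and `U` is a uniform strip
      (Function.Periodic A (2 * Real.pi) → Function.Periodic B (2 * Real.pi) →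
        Function.Periodic Pt (2 * Real.pi) ∧ Function.Periodic Pd (2 * Real.pi) ∧
        (∃ ε : ℝ, 0 < ε ∧ U = {z : ℂ | |z.im| < ε}) ∧
        ∀ z ∈ U, F (z + 2 * Real.pi) = F z) := by
  have hB1 : ∀ k, (Matrix.powDefect (B k) 1).PosSemidef := fun k => by
    rw [Matrix.powDefect, pow_one]; exact (hAB k).2
  obtain ⟨d, hd⟩ := exists_eventually_finrank_preservedSubspace_eq hB hB1
  refine ⟨⟨d, finite_setOf_not_of_eventually_nhdsNE hd⟩, ?_⟩
  obtain ⟨Q, hQ, hPQ⟩ := exists_entrywiseAnalytic_eventuallyEq_preservedProjector hB hB1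
  have hQc := hQ.continuous
  -- Functions `ι → ι → ℂ` carry the norm that the type of matrices lacks.
  have hQpi : AnalyticOnNhd ℝ (fun k => (fun i j => Q k i j : ι → ι → ℂ)) Set.univ :=
    AnalyticOnNhd.pi fun i => AnalyticOnNhd.pi fun j => hQ i j
  have hentry : ∀ {U : Set ℂ} {F : ℂ → ι → ι → ℂ}, AnalyticOnNhd ℂ F U → ∀ i j,
      AnalyticOnNhd ℂ (fun z => F z i j) U := fun hF i j z hz =>
    (analyticAt_pi_iff.1 (analyticAt_pi_iff.1 (hF z hz) i) j)
  have hext : ∃ (U : Set ℂ) (F : ℂ → Matrix ι ι ℂ), IsOpen U ∧ (∀ k : ℝ, (k : ℂ) ∈ U) ∧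
      (∀ i j, AnalyticOnNhd ℂ (fun z => F z i j) U) ∧ (∀ k : ℝ, F (k : ℂ) = Q k) ∧
      (Function.Periodic B (2 * Real.pi) → (∃ ε : ℝ, 0 < ε ∧ U = {z : ℂ | |z.im| < ε}) ∧
        ∀ z ∈ U, F (z + 2 * Real.pi) = F z) := by
    by_cases hper : Function.Periodic B (2 * Real.pi)
    · obtain ⟨ε, F, hε, hF, hFQ, hFp⟩ := hQpi.exists_complex_extension_strip Real.two_pi_pos
        (periodic_of_eventuallyEq_preservedProjector hQc hPQ hper)
      refine ⟨{z | |z.im| < ε}, F, isOpen_lt (by fun_prop) continuous_const, by simpa using hε,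
        hentry hF, hFQ, fun _ => ⟨⟨ε, hε, rfl⟩, fun z hz => ?_⟩⟩
      have h := hFp z hz
      rw [Complex.ofReal_mul, Complex.ofReal_ofNat] at h
      exact h
    · obtain ⟨U, F, hUo, hU, hF, hFQ⟩ := hQpi.exists_complex_extension
      exact ⟨U, F, hUo, hU, hentry hF, hFQ, fun h => absurd h hper⟩
  obtain ⟨U, F, hUo, hU, hF, hFQ, hper⟩ := hext
  refine ⟨Q, fun k => preservedProjector (B k) - Q k, U, F, fun k => (add_sub_cancel _ _).symm,
    isHermitianProjector_of_eventuallyEq_preservedProjector hQc hPQ,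
    isHermitianProjector_preservedProjector_sub hB hB1 hQc hPQ, ?_, hUo, hU, hF, hFQ,
    fun _ hBp => ?_⟩
  · exact finite_setOf_not_of_eventually_nhdsNE fun x =>
      (hPQ x).mono fun k hk => sub_eq_zero.2 hk
  · have hQp := periodic_of_eventuallyEq_preservedProjector hQc hPQ hBp
    exact ⟨hQp, fun k => by simp only [hBp k, hQp k], hper hBp⟩
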